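/- Let $H$ be a complex Hilbert space, not necessarily separable, of dimension at least $2$. An effect on $H$ is a bounded self-adjoint operator $A$ on $H$ with $0\le A\le I$; it is called scalar if $A=tI$ for some number $t$, and finite-rank if its range is finite-dimensional. Two effects $A,B$ are coexistent, written $A\sim B$, if there are effects $E,F,G$ on $H$ such that $A=E+G$, $B=F+G$ and $E+F+G$ is an effect. For an effect $A$ let $A^\sim$ be the set of all effects $C$ with $C\sim A$, and let $\mathcal F(H)$ be the set of all finite-rank effects on $H$. Then for any effects $A,B$ on $H$ the following are equivalent: (i) $B=A$, or $B=I-A$, or both $A$ and $B$ are scalar; (ii) $A^\sim=B^\sim$. Moreover, if $H$ is separable, then (i) and (ii) are also equivalent to (iii) $A^\sim\cap\mathcal F(H)=B^\sim\cap\mathcal F(H)$. -/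

import Mathlib

section HilbertSpaceEffects

variable (H : Type*) [NormedAddCommGroup H] [InnerProductSpace ℂ H] [CompleteSpace H]

/-- The effects on `H`: bounded self-adjoint operators `A` with `0 ≤ A ≤ I` in the Loewner
(quadratic form) order. -/
def EffectSet : Set (H →L[ℂ] H) :=
  {A | IsSelfAdjoint A ∧ 0 ≤ A ∧ A ≤ 1}

/-- The finite-rank effects on `H`. -/
def FiniteRankEffectSet : Set (H →L[ℂ] H) :=
  {A | A ∈ EffectSet H ∧ FiniteDimensional ℂ (LinearMap.range (A : H →ₗ[ℂ] H))}

/-- The scalar effects on `H`, that is, the effects that are scalar multiples of the identity. -/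
def ScalarEffectSet : Set (H →L[ℂ] H) :=
  {A | A ∈ EffectSet H ∧ ∃ t : ℂ, A = t • (1 : H →L[ℂ] H)}

variable {H}

/-- The ortho-complement `I - A`. -/
def orthoComplement (A : H →L[ℂ] H) : H →L[ℂ] H := 1 - A

/-- The effects `A` and `B` are coexistent: `A = E + G` and `B = F + G` for some effects
`E, F, G` whose sum is an effect. -/
def Coexistent (A B : H →L[ℂ] H) : Prop :=
  ∃ E ∈ EffectSet H, ∃ F ∈ EffectSet H, ∃ G ∈ EffectSet H,
    A = E + G ∧ B = F + G ∧ E + F + G ∈ EffectSet H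

/-- The set of all effects that are coexistent with `A`. -/
def coexistenceSet (A : H →L[ℂ] H) : Set (H →L[ℂ] H) :=
  {C | C ∈ EffectSet H ∧ Coexistent C A}

end HilbertSpaceEffects

/-!
The strength `strength A x` of an effect `A` along a vector `x` is the largest `s` with
`s • |x⟩⟨x| ≤ A`. A positive operator below a multiple of `|x⟩⟨x|` is a multiple of `|x⟩⟨x|`, so the
largest multiple of `|x⟩⟨x|` that coexists with `A` has the factor
`f_A(x) = strength A x + strength (1 - A) x`. Already the rank-one effects that coexist with `A`
therefore determine the function `f_A`, and everything follows from
`eq_or_isScalarOp_of_strength_add_eq`: if `f_A = f_B`, then `B = A`, or `B = 1 - A`, or both are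
scalar. Separability is not needed for this.

Along `x ≠ 0` the strength is positive exactly if `x` is in the range of `A^{1/2}` (`sqrtRange A`),
where its inverse is the quadratic form of `A⁻¹` (`strength_sqrt`). The strength function determines
`A` (`eq_of_strength_eq`). The equality `f_A = f_B` says first that the union of the ranges of
`A^{1/2}` and `(1 - A)^{1/2}`, two subspaces that span `H`, is the same for `B`.

If both of these subspaces are proper, then, up to exchanging `B` and `1 - B`, they are the same
for `A` and for `B`. On lines inside the first one and not inside the second one only the
strengths of `A` and of `B` remain, so these are equal and `A = B` (`eq_of_exists_notMem`).
Otherwise `A` and `B` may be taken invertible. If neither `1 - A` nor `1 - B` is invertible, the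
same argument applies. In the remaining cases `f_A = f_B` becomes a polynomial relation between the forms of the
inverses of `A`, `1 - A`, `B`, `1 - B`, for instance `(p + q) r s = (r + s) p q` if all of these
exist. Polarized (`inner_eq_of_inner_self_eq`), it says that where the sesquilinear form of `A⁻¹`
vanishes, so does one of the others; hence `A` is a multiple of `1 - A`, of `B` or of `1 - B`
(`exists_eq_smul_of_prod_inner_inverse_eq_zero`). The same holds for `1 - A` and `B`, and linear
algebra finishes the proof.
-/

section Strength

open scoped InnerProductSpace ComplexOrder

variable {H : Type*} [NormedAddCommGroup H] [InnerProductSpace ℂ H]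

/-! ### Strength along a vector -/

/-- The real numbers `s ≥ 0` with `s • |x⟩⟨x| ≤ A`, the operator inequality being written with
quadratic forms. -/
def strengthSet (A : H →L[ℂ] H) (x : H) : Set ℝ :=
  {s | 0 ≤ s ∧ ∀ y, s * ‖⟪x, y⟫_ℂ‖ ^ 2 ≤ A.reApplyInnerSelf y}

/-- The strength of `A` along `x`: the largest `s` with `s • |x⟩⟨x| ≤ A`. The vector `x` is not
normalised. At `x = 0` the set is unbounded and `sSup` returns `0`, so that `(strength A x)⁻¹` is a
quadratic form on all of `sqrtRange A`. -/
noncomputable def strength (A : H →L[ℂ] H) (x : H) : ℝ := sSup (strengthSet A x)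

theorem strength_nonneg (A : H →L[ℂ] H) (x : H) : 0 ≤ strength A x :=
  Real.sSup_nonneg fun _ hs => hs.1

theorem smul_rankOne_nonneg (x : H) {s : ℝ} (hs : 0 ≤ s) :
    0 ≤ (s : ℂ) • InnerProductSpace.rankOne ℂ x x :=
  (ContinuousLinearMap.nonneg_iff_isPositive _).2
    ((InnerProductSpace.isPositive_rankOne_self x).smul_of_nonneg (by exact_mod_cast hs))

variable [CompleteSpace H]

theorem mem_effectSet_iff {A : H →L[ℂ] H} : A ∈ EffectSet H ↔ 0 ≤ A ∧ 0 ≤ 1 - A := by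
  constructor
  · rintro ⟨-, h0, h1⟩
    exact ⟨h0, sub_nonneg.2 h1⟩
  · rintro ⟨h0, h1⟩
    exact ⟨((ContinuousLinearMap.nonneg_iff_isPositive A).1 h0).isSelfAdjoint, h0,
      sub_nonneg.1 h1⟩

theorem orthoComplement_mem_effectSet {A : H →L[ℂ] H} (hA : A ∈ EffectSet H) :
    1 - A ∈ EffectSet H := by
  rw [mem_effectSet_iff] at hA ⊢
  exact ⟨hA.2, by simpa using hA.1⟩

theorem sqrt_isSelfAdjoint (A : H →L[ℂ] H) : IsSelfAdjoint (CFC.sqrt A) :=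
  IsSelfAdjoint.of_nonneg (CFC.sqrt_nonneg A)

theorem inner_sqrt_left (A : H →L[ℂ] H) (x y : H) :
    ⟪CFC.sqrt A x, y⟫_ℂ = ⟪x, CFC.sqrt A y⟫_ℂ :=
  (sqrt_isSelfAdjoint A).isSymmetric x y

theorem sqrt_sqrt_apply {A : H →L[ℂ] H} (hA : 0 ≤ A) (x : H) :
    CFC.sqrt A (CFC.sqrt A x) = A x := by
  have h := CFC.sqrt_mul_sqrt_self A hA
  exact congrArg (fun T : H →L[ℂ] H => T x) h

theorem reApplyInnerSelf_eq_norm_sqrt_sq {A : H →L[ℂ] H} (hA : 0 ≤ A) (x : H) :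
    A.reApplyInnerSelf x = ‖CFC.sqrt A x‖ ^ 2 := by
  rw [ContinuousLinearMap.reApplyInnerSelf_apply, ← sqrt_sqrt_apply hA, inner_sqrt_left,
    inner_self_eq_norm_sq]

/-- The range of `A^{1/2}`, for `0 ≤ A`: the domain of the quadratic form of the possibly unbounded
inverse `A⁻¹`. -/
noncomputable def sqrtRange (A : H →L[ℂ] H) : Submodule ℂ H :=
  (CFC.sqrt A).range

theorem exists_orthogonal_ker_of_mem_sqrtRange {A : H →L[ℂ] H} {x : H} (hx : x ∈ sqrtRange A) :
    ∃ v ∈ (CFC.sqrt A).kerᗮ, CFC.sqrt A v = x := by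
  obtain ⟨w, hw⟩ := hx
  obtain ⟨k, hk, v, hv, rfl⟩ := (CFC.sqrt A).ker.exists_add_mem_mem_orthogonal w
  refine ⟨v, hv, ?_⟩
  have hk0 : CFC.sqrt A k = 0 := hk
  change CFC.sqrt A (k + v) = x at hw
  rwa [map_add, hk0, zero_add] at hw

/-- If `s • |x⟩⟨x| ≤ A` with `s > 0`, then `A^{1/2} y ↦ ⟪x, y⟫` is a bounded functional on the range
of `A^{1/2}`; a vector that represents an extension of it is a preimage of `x`. -/
theorem mem_sqrtRange_of_bound {A : H →L[ℂ] H} (hA : 0 ≤ A) {x : H} {s : ℝ} (hs : 0 < s)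
    (h : ∀ y, s * ‖⟪x, y⟫_ℂ‖ ^ 2 ≤ A.reApplyInnerSelf y) : x ∈ sqrtRange A := by
  set S := CFC.sqrt A
  let R : H →ₗ[ℂ] S.range := (S : H →ₗ[ℂ] H).rangeRestrict
  obtain ⟨g, hg⟩ := R.exists_rightInverse_of_surjective (LinearMap.range_rangeRestrict _)
  have hbound : ∀ y, ‖⟪x, y⟫_ℂ‖ ≤ (Real.sqrt s)⁻¹ * ‖S y‖ := by
    intro y
    have h1 := h y
    rw [reApplyInnerSelf_eq_norm_sqrt_sq hA] at h1
    have hs' := Real.sqrt_pos.2 hs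
    rw [inv_mul_eq_div, le_div_iff₀ hs', ← abs_of_nonneg (norm_nonneg (S y)),
      ← abs_of_nonneg (mul_nonneg (norm_nonneg ⟪x, y⟫_ℂ) hs'.le), ← sq_le_sq, mul_pow,
      Real.sq_sqrt hs.le, mul_comm]
    exact h1
  have hSg : ∀ w : S.range, S (g w) = w := fun w =>
    congrArg Subtype.val (LinearMap.congr_fun hg w)
  let f : StrongDual ℂ S.range :=
    LinearMap.mkContinuous ((innerSL ℂ x : H →ₗ[ℂ] ℂ).comp g) (Real.sqrt s)⁻¹ (fun w => by
      have := hbound (g w)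
      rw [hSg] at this
      exact this)
  obtain ⟨F, hF, -⟩ := exists_extension_norm_eq S.range f
  refine ⟨(InnerProductSpace.toDual ℂ H).symm F, ?_⟩
  refine ext_inner_right ℂ fun y => ?_
  have h1 : F (S y) = ⟪x, g (R y)⟫_ℂ := hF (R y)
  have h2 : ⟪x, g (R y) - y⟫_ℂ = 0 := by
    have := hbound (g (R y) - y)
    have h3 : S (g (R y) - y) = 0 := by
      rw [map_sub, hSg]; exact sub_self _
    rw [h3, norm_zero, mul_zero] at this
    exact norm_le_zero_iff.1 this
  rw [inner_sub_right, sub_eq_zero] at h2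
  change ⟪S _, y⟫_ℂ = _
  rw [inner_sqrt_left, InnerProductSpace.toDual_symm_apply, h1, h2]

theorem strengthSet_eq_zero_of_notMem {A : H →L[ℂ] H} (hA : 0 ≤ A) {x : H}
    (hx : x ∉ sqrtRange A) : strengthSet A x = {0} := by
  ext s
  constructor
  · rintro ⟨h0, h⟩
    by_contra hs
    exact hx (mem_sqrtRange_of_bound hA (lt_of_le_of_ne h0 (Ne.symm hs)) h)
  · rintro rfl
    refine ⟨le_rfl, fun y => ?_⟩
    rw [reApplyInnerSelf_eq_norm_sqrt_sq hA, zero_mul]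
    positivity

theorem mem_strengthSet_sqrt_iff {A : H →L[ℂ] H} (hA : 0 ≤ A) {v : H}
    (hv : v ∈ (CFC.sqrt A).kerᗮ) {s : ℝ} :
    s ∈ strengthSet A (CFC.sqrt A v) ↔ 0 ≤ s ∧ s * ‖v‖ ^ 2 ≤ 1 := by
  refine and_congr_right fun h0 => ⟨fun h => ?_, fun h y => ?_⟩
  · -- The inequality `s |⟪v, w⟫|² ≤ ‖w‖²` extends from the range of `A^{1/2}` to its closure,
    -- which contains `v` itself.
    have hcl : v ∈ closure ((CFC.sqrt A).range : Set H) := by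
      rw [ContinuousLinearMap.orthogonal_ker, (sqrt_isSelfAdjoint A).adjoint_eq] at hv
      exact hv
    have hclosed : IsClosed {w : H | s * ‖⟪v, w⟫_ℂ‖ ^ 2 ≤ ‖w‖ ^ 2} :=
      isClosed_le (by fun_prop) (by fun_prop)
    have hsub : ((CFC.sqrt A).range : Set H) ⊆ {w : H | s * ‖⟪v, w⟫_ℂ‖ ^ 2 ≤ ‖w‖ ^ 2} := by
      rintro _ ⟨y, rfl⟩
      have := h y
      rw [inner_sqrt_left, reApplyInnerSelf_eq_norm_sqrt_sq hA] at this
      exact this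
    have h1 : s * ‖⟪v, v⟫_ℂ‖ ^ 2 ≤ ‖v‖ ^ 2 := closure_minimal hsub hclosed hcl
    rcases eq_or_ne v 0 with rfl | hv0
    · simp
    · rw [inner_self_eq_norm_sq_to_K] at h1
      have hpos : 0 < ‖v‖ ^ 2 := by positivity
      simp only [norm_pow, RCLike.norm_ofReal, abs_norm] at h1
      refine le_of_mul_le_mul_right ?_ hpos
      calc s * ‖v‖ ^ 2 * ‖v‖ ^ 2 = s * (‖v‖ ^ 2) ^ 2 := by ring
        _ ≤ 1 * ‖v‖ ^ 2 := by rwa [one_mul]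
  · rw [inner_sqrt_left, reApplyInnerSelf_eq_norm_sqrt_sq hA]
    calc s * ‖⟪v, CFC.sqrt A y⟫_ℂ‖ ^ 2 ≤ s * (‖v‖ * ‖CFC.sqrt A y‖) ^ 2 := by
          gcongr; exact norm_inner_le_norm _ _
      _ = s * ‖v‖ ^ 2 * ‖CFC.sqrt A y‖ ^ 2 := by ring
      _ ≤ 1 * ‖CFC.sqrt A y‖ ^ 2 := by gcongr
      _ = _ := one_mul _

theorem strengthSet_sqrt {A : H →L[ℂ] H} (hA : 0 ≤ A) {v : H}
    (hv : v ∈ (CFC.sqrt A).kerᗮ) (hv0 : v ≠ 0) :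
    strengthSet A (CFC.sqrt A v) = Set.Icc 0 (‖v‖ ^ 2)⁻¹ := by
  ext s
  have hpos : 0 < ‖v‖ ^ 2 := by positivity
  rw [mem_strengthSet_sqrt_iff hA hv, Set.mem_Icc, ← one_div, le_div_iff₀ hpos]

/-- The inverse of the strength is the quadratic form of `A⁻¹`. The case `v = 0` is included, where
both sides are `0` by convention. -/
theorem strength_sqrt {A : H →L[ℂ] H} (hA : 0 ≤ A) {v : H}
    (hv : v ∈ (CFC.sqrt A).kerᗮ) : strength A (CFC.sqrt A v) = (‖v‖ ^ 2)⁻¹ := by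
  rcases eq_or_ne v 0 with rfl | hv0
  · have h : strengthSet A (CFC.sqrt A 0) = Set.Ici 0 := by
      ext s
      rw [mem_strengthSet_sqrt_iff hA hv]
      simp
    rw [strength, h, Real.sSup_of_not_bddAbove (not_bddAbove_Ici 0)]
    simp
  · rw [strength, strengthSet_sqrt hA hv hv0, csSup_Icc (by positivity)]

theorem strength_of_notMem {A : H →L[ℂ] H} (hA : 0 ≤ A) {x : H} (hx : x ∉ sqrtRange A) :
    strength A x = 0 := by
  rw [strength, strengthSet_eq_zero_of_notMem hA hx, csSup_singleton]

theorem strengthSet_eq_Icc {A : H →L[ℂ] H} (hA : 0 ≤ A) {x : H} (hx : x ≠ 0) :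
    strengthSet A x = Set.Icc 0 (strength A x) := by
  by_cases hxA : x ∈ sqrtRange A
  · obtain ⟨v, hv, rfl⟩ := exists_orthogonal_ker_of_mem_sqrtRange hxA
    rw [strength_sqrt hA hv, strengthSet_sqrt hA hv]
    rintro rfl
    simp at hx
  · rw [strength_of_notMem hA hxA, strengthSet_eq_zero_of_notMem hA hxA, Set.Icc_self]

theorem mem_sqrtRange_iff_strength_pos {A : H →L[ℂ] H} (hA : 0 ≤ A) {x : H} (hx : x ≠ 0) :
    x ∈ sqrtRange A ↔ 0 < strength A x := by
  constructor
  · intro h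
    obtain ⟨v, hv, rfl⟩ := exists_orthogonal_ker_of_mem_sqrtRange h
    have hv0 : v ≠ 0 := by rintro rfl; simp at hx
    rw [strength_sqrt hA hv]
    positivity
  · intro h
    by_contra hxA
    rw [strength_of_notMem hA hxA] at h
    exact h.false

/-- On the range of `A` itself the strength has a formula without square roots. -/
theorem strength_apply {A : H →L[ℂ] H} (hA : 0 ≤ A) (u : H) :
    strength A (A u) = (A.reApplyInnerSelf u)⁻¹ := by
  have hv : CFC.sqrt A u ∈ (CFC.sqrt A).kerᗮ := by
    rw [ContinuousLinearMap.orthogonal_ker, (sqrt_isSelfAdjoint A).adjoint_eq]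
    exact Submodule.le_topologicalClosure _ ⟨u, rfl⟩
  rw [← sqrt_sqrt_apply hA, strength_sqrt hA hv, reApplyInnerSelf_eq_norm_sqrt_sq hA]

/-- The strength function determines the order: at `x = A u` the inequality
`strength A x • |x⟩⟨x| ≤ B`, tested on `u`, reads `⟪A u, u⟫ ≤ ⟪B u, u⟫`. -/
theorem le_of_strength_le {A B : H →L[ℂ] H} (hA : 0 ≤ A) (hB : 0 ≤ B)
    (h : ∀ x, x ≠ 0 → strength A x ≤ strength B x) : A ≤ B := by
  have hA' := (ContinuousLinearMap.nonneg_iff_isPositive A).1 hA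
  have hB' := (ContinuousLinearMap.nonneg_iff_isPositive B).1 hB
  rw [ContinuousLinearMap.le_def, ContinuousLinearMap.isPositive_def']
  refine ⟨hB'.isSelfAdjoint.sub hA'.isSelfAdjoint, fun u => ?_⟩
  have hsub : (B - A).reApplyInnerSelf u = B.reApplyInnerSelf u - A.reApplyInnerSelf u := by
    simp [ContinuousLinearMap.reApplyInnerSelf_apply, inner_sub_left]
  rw [hsub, sub_nonneg]
  rcases eq_or_ne (A u) 0 with h0 | h0
  · have : A.reApplyInnerSelf u = 0 := by
      simp [ContinuousLinearMap.reApplyInnerSelf_apply, h0]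
    rw [this]
    exact hB'.2 u
  · have hmem : strength A (A u) ∈ strengthSet B (A u) := by
      rw [strengthSet_eq_Icc hB h0]
      exact ⟨strength_nonneg _ _, h _ h0⟩
    have h1 := hmem.2 u
    rw [strength_apply hA] at h1
    have hnorm : ‖⟪A u, u⟫_ℂ‖ = A.reApplyInnerSelf u := by
      rw [← sqrt_sqrt_apply hA, inner_sqrt_left, reApplyInnerSelf_eq_norm_sqrt_sq hA,
        inner_self_eq_norm_sq_to_K]
      simp
    rw [hnorm] at h1
    rcases eq_or_ne (A.reApplyInnerSelf u) 0 with h2 | h2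
    · rw [h2]; exact hB'.2 u
    · calc A.reApplyInnerSelf u = (A.reApplyInnerSelf u)⁻¹ * A.reApplyInnerSelf u ^ 2 := by
            field_simp
        _ ≤ _ := h1

theorem eq_of_strength_eq {A B : H →L[ℂ] H} (hA : 0 ≤ A) (hB : 0 ≤ B)
    (h : ∀ x, x ≠ 0 → strength A x = strength B x) : A = B :=
  le_antisymm (le_of_strength_le hA hB fun x hx => (h x hx).le)
    (le_of_strength_le hB hA fun x hx => (h x hx).ge)

/-! ### Coexistence with rank-one effects -/

theorem smul_rankOne_le_iff {A : H →L[ℂ] H} (hA : IsSelfAdjoint A) (x : H) (s : ℝ) :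
    (s : ℂ) • InnerProductSpace.rankOne ℂ x x ≤ A ↔
      ∀ y, s * ‖⟪x, y⟫_ℂ‖ ^ 2 ≤ A.reApplyInnerSelf y := by
  have hsa : IsSelfAdjoint ((s : ℂ) • InnerProductSpace.rankOne ℂ x x) := by
    refine IsSelfAdjoint.smul (by simp [IsSelfAdjoint]) ?_
    exact (InnerProductSpace.isPositive_rankOne_self x).isSelfAdjoint
  have key : ∀ y, (A - (s : ℂ) • InnerProductSpace.rankOne ℂ x x).reApplyInnerSelf y =
      A.reApplyInnerSelf y - s * ‖⟪x, y⟫_ℂ‖ ^ 2 := by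
    intro y
    simp only [ContinuousLinearMap.reApplyInnerSelf_apply, sub_apply,
      smul_apply, InnerProductSpace.rankOne_apply, inner_sub_left, map_sub,
      inner_smul_left, Complex.conj_ofReal]
    rw [mul_comm (starRingEnd ℂ _), RCLike.mul_conj]
    simp [← Complex.ofReal_pow]
  rw [ContinuousLinearMap.le_def, ContinuousLinearMap.isPositive_def']
  simp only [hA.sub hsa, true_and, key, sub_nonneg]

/-- A positive operator dominated by a multiple of `|x⟩⟨x|` is itself a multiple of `|x⟩⟨x|`. -/
theorem eq_smul_rankOne_of_le {G : H →L[ℂ] H} (hG : 0 ≤ G) {x : H} (hx : x ≠ 0) {t : ℝ}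
    (h : G ≤ (t : ℂ) • InnerProductSpace.rankOne ℂ x x) :
    ∃ s : ℝ, 0 ≤ s ∧ G = (s : ℂ) • InnerProductSpace.rankOne ℂ x x := by
  have hker : ∀ y, ⟪x, y⟫_ℂ = 0 → G y = 0 := by
    intro y hy
    have h1 : G.reApplyInnerSelf y ≤ 0 := by
      have h2 := ((ContinuousLinearMap.le_def _ _).1 h).2 y
      change 0 ≤ ((t : ℂ) • InnerProductSpace.rankOne ℂ x x - G).reApplyInnerSelf y at h2
      simp only [ContinuousLinearMap.reApplyInnerSelf_apply, sub_apply,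
        smul_apply, InnerProductSpace.rankOne_apply, hy, zero_smul, smul_zero,
        zero_sub, inner_neg_left, map_neg] at h2 ⊢
      linarith
    rw [reApplyInnerSelf_eq_norm_sqrt_sq hG] at h1
    have h3 : CFC.sqrt G y = 0 := by
      rw [← norm_eq_zero]
      exact pow_eq_zero_iff two_ne_zero |>.1 (le_antisymm h1 (by positivity))
    rw [← sqrt_sqrt_apply hG, h3, map_zero]
  have hxx : ⟪x, x⟫_ℂ ≠ 0 := inner_self_ne_zero.2 hx
  have hsymm : ∀ u w, ⟪G u, w⟫_ℂ = ⟪u, G w⟫_ℂ :=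
    ((ContinuousLinearMap.nonneg_iff_isPositive G).1 hG).isSymmetric
  have hdec : ∀ y, G y = (⟪x, y⟫_ℂ / ⟪x, x⟫_ℂ) • G x := by
    intro y
    have := hker (y - (⟪x, y⟫_ℂ / ⟪x, x⟫_ℂ) • x) (by
      rw [inner_sub_right, inner_smul_right, div_mul_cancel₀ _ hxx, sub_self])
    rwa [map_sub, map_smul, sub_eq_zero] at this
  have hGx : G x = (⟪x, G x⟫_ℂ / ⟪x, x⟫_ℂ) • x := by
    refine ext_inner_right ℂ fun w => ?_
    rw [hsymm, hdec w, inner_smul_right, inner_smul_left, map_div₀, inner_conj_symm,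
      inner_conj_symm, hsymm]
    ring
  have hre : ⟪x, G x⟫_ℂ = ((G.reApplyInnerSelf x : ℝ) : ℂ) := by
    rw [reApplyInnerSelf_eq_norm_sqrt_sq hG, ← sqrt_sqrt_apply hG, ← inner_sqrt_left,
      inner_self_eq_norm_sq_to_K]
    push_cast; rfl
  refine ⟨G.reApplyInnerSelf x / ‖x‖ ^ 4,
    div_nonneg (((ContinuousLinearMap.nonneg_iff_isPositive G).1 hG).2 x) (by positivity), ?_⟩
  ext y
  have hn : (‖x‖ : ℂ) ≠ 0 := by simpa using hx
  rw [hdec y, hGx, hre, smul_smul, smul_apply,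
    InnerProductSpace.rankOne_apply, smul_smul, inner_self_eq_norm_sq_to_K]
  congr 1
  push_cast
  simp only [Complex.coe_algebraMap]
  field_simp

theorem smul_rankOne_le_of_mem {A : H →L[ℂ] H} (hA : 0 ≤ A) {x : H} {s : ℝ}
    (hs : s ∈ strengthSet A x) : (s : ℂ) • InnerProductSpace.rankOne ℂ x x ≤ A :=
  (smul_rankOne_le_iff (IsSelfAdjoint.of_nonneg hA) x s).2 hs.2

theorem le_strength_add_of_coexistent {A : H →L[ℂ] H} (hA : A ∈ EffectSet H) {x : H}
    (hx : x ≠ 0) {t : ℝ}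
    (h : Coexistent ((t : ℂ) • InnerProductSpace.rankOne ℂ x x) A) :
    t ≤ strength A x + strength (1 - A) x := by
  obtain ⟨E, hE, F, hF, G, hG, hC, hAF, hsum⟩ := h
  have hA' := mem_effectSet_iff.1 hA
  have hE0 := hE.2.1
  have hG0 := hG.2.1
  have hle : ∀ {M : H →L[ℂ] H} {s : ℝ}, 0 ≤ s → 0 ≤ M →
      (s : ℂ) • InnerProductSpace.rankOne ℂ x x ≤ M → s ≤ strength M x := by
    intro M s hs hM hsM
    have hmem : s ∈ strengthSet M x :=
      ⟨hs, (smul_rankOne_le_iff (IsSelfAdjoint.of_nonneg hM) x s).1 hsM⟩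
    rw [strengthSet_eq_Icc hM hx] at hmem
    exact hmem.2
  obtain ⟨s, hs, rfl⟩ := eq_smul_rankOne_of_le (t := t) hG0 hx (by
    rw [hC]; exact le_add_of_nonneg_left hE0)
  obtain ⟨r, hr, rfl⟩ := eq_smul_rankOne_of_le (t := t) hE0 hx (by
    rw [hC]; exact le_add_of_nonneg_right hG0)
  have h1 : s ≤ strength A x := hle hs hA'.1 (by
    rw [hAF]; exact le_add_of_nonneg_left hF.2.1)
  have h2 : r ≤ strength (1 - A) x := hle hr hA'.2 (by
    rw [le_sub_iff_add_le, hAF, ← add_assoc]; exact hsum.2.2)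
  have h3 : t = r + s := by
    rw [← add_smul] at hC
    have := smul_left_injective ℂ (InnerProductSpace.rankOne_ne_zero (𝕜 := ℂ) hx hx) hC
    exact_mod_cast this
  linarith

/-- Together with `le_strength_add_of_coexistent`: the largest multiple of `|x⟩⟨x|` that coexists
with `A` has the factor `strength A x + strength (1 - A) x`. -/
theorem smul_rankOne_mem_coexistenceSet {A : H →L[ℂ] H} (hA : A ∈ EffectSet H) {x : H}
    (hx : x ≠ 0) :
    ((strength A x + strength (1 - A) x : ℝ) : ℂ) • InnerProductSpace.rankOne ℂ x x ∈
      coexistenceSet A ∩ FiniteRankEffectSet H := by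
  have hA' := mem_effectSet_iff.1 hA
  set E := (strength (1 - A) x : ℂ) • InnerProductSpace.rankOne ℂ x x with hEdef
  set G := (strength A x : ℂ) • InnerProductSpace.rankOne ℂ x x with hGdef
  have hE0 : 0 ≤ E := smul_rankOne_nonneg x (strength_nonneg _ _)
  have hG0 : 0 ≤ G := smul_rankOne_nonneg x (strength_nonneg _ _)
  have hmax : ∀ {M : H →L[ℂ] H}, 0 ≤ M →
      (strength M x : ℂ) • InnerProductSpace.rankOne ℂ x x ≤ M :=
    fun {M} hM => smul_rankOne_le_of_mem hM (by
      rw [strengthSet_eq_Icc hM hx]; exact ⟨strength_nonneg _ _, le_rfl⟩)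
  have hGA : G ≤ A := hmax hA'.1
  have hEA : E ≤ 1 - A := hmax hA'.2
  have hEA' : E + A ≤ 1 := by rwa [← le_sub_iff_add_le]
  have hA1 : A ≤ 1 := hA.2.2
  have hC : ((strength A x + strength (1 - A) x : ℝ) : ℂ) • InnerProductSpace.rankOne ℂ x x =
      E + G := by
    rw [hEdef, hGdef, ← add_smul, Complex.ofReal_add, add_comm]
  have mem : ∀ {M : H →L[ℂ] H}, 0 ≤ M → M ≤ 1 → M ∈ EffectSet H := fun h0 h1 =>
    ⟨IsSelfAdjoint.of_nonneg h0, h0, h1⟩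
  have hsum : E + (A - G) + G = E + A := by abel
  have hCeff : E + G ∈ EffectSet H :=
    mem (add_nonneg hE0 hG0) ((add_le_add_right hGA E).trans hEA')
  refine ⟨⟨hC ▸ hCeff, E, mem hE0 (hEA.trans (sub_le_self _ hA'.1)), A - G,
    mem (sub_nonneg.2 hGA) ((sub_le_self _ hG0).trans hA1), G, mem hG0 (hGA.trans hA1), hC,
    by abel, ?_⟩, hC ▸ hCeff, ?_⟩
  · rw [hsum]
    exact mem (add_nonneg hE0 hA'.1) hEA'
  · refine Submodule.finiteDimensional_of_le (S₂ := Submodule.span ℂ {x}) ?_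
    rintro _ ⟨y, rfl⟩
    exact Submodule.smul_mem _ _ (Submodule.smul_mem _ _ (Submodule.mem_span_singleton_self x))

theorem strength_add_eq_of_coexistenceSet_eq {A B : H →L[ℂ] H} (hA : A ∈ EffectSet H)
    (hB : B ∈ EffectSet H)
    (h : coexistenceSet A ∩ FiniteRankEffectSet H = coexistenceSet B ∩ FiniteRankEffectSet H)
    {x : H} (hx : x ≠ 0) :
    strength A x + strength (1 - A) x = strength B x + strength (1 - B) x :=
  le_antisymm
    (le_strength_add_of_coexistent hB hx (h ▸ smul_rankOne_mem_coexistenceSet hA hx).1.2)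
    (le_strength_add_of_coexistent hA hx (h.symm ▸ smul_rankOne_mem_coexistenceSet hB hx).1.2)

/-! ### Coexistence sets of complements and of scalar effects -/

theorem coexistenceSet_orthoComplement_subset (A : H →L[ℂ] H) :
    coexistenceSet A ⊆ coexistenceSet (1 - A) := by
  rintro C ⟨hC, E, hE, F, hF, G, hG, hCE, hAF, hsum⟩
  refine ⟨hC, G, hG, 1 - (E + F + G), orthoComplement_mem_effectSet hsum, E, hE, ?_, ?_, ?_⟩
  · rw [hCE, add_comm]
  · rw [hAF]; abel
  · have : G + (1 - (E + F + G)) + E = 1 - F := by abel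
    rw [this]
    exact orthoComplement_mem_effectSet hF

theorem coexistenceSet_orthoComplement (A : H →L[ℂ] H) :
    coexistenceSet (1 - A) = coexistenceSet A := by
  refine Set.Subset.antisymm ?_ (coexistenceSet_orthoComplement_subset A)
  have h := coexistenceSet_orthoComplement_subset (1 - A)
  rwa [sub_sub_cancel] at h

/-- A scalar effect `t` coexists with every effect `C`, with `E = (1 - t) C`,
`F = t (1 - C)`, `G = t C`. -/
theorem coexistenceSet_of_scalar [Nontrivial H] {A : H →L[ℂ] H} (hA : A ∈ ScalarEffectSet H) :
    coexistenceSet A = EffectSet H := by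
  obtain ⟨hA, t, rfl⟩ := hA
  have hA' := mem_effectSet_iff.1 hA
  refine Set.Subset.antisymm (fun C hC => hC.1) fun C hC => ⟨hC, ?_⟩
  have hnn : ∀ {c : ℂ}, 0 ≤ c • (1 : H →L[ℂ] H) → 0 ≤ c := by
    intro c hc
    obtain ⟨x, hx⟩ := exists_ne (0 : H)
    have h1 := ((ContinuousLinearMap.nonneg_iff_isPositive _).1 hc).inner_nonneg_right x
    rw [smul_apply, inner_smul_right, one_apply_eq_self, inner_self_eq_norm_sq_to_K] at h1
    have h2 : (0 : ℂ) ≤ (((‖x‖ ^ 2)⁻¹ : ℝ) : ℂ) := Complex.zero_le_real.2 (by positivity)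
    have h3 : (‖x‖ : ℂ) ≠ 0 := by simpa using hx
    have h4 := mul_nonneg h1 h2
    push_cast at h4
    exact (mul_inv_cancel_right₀ (pow_ne_zero 2 h3) c) ▸ h4
  have ht0 : 0 ≤ t := hnn hA'.1
  have ht1 : 0 ≤ 1 - t := hnn (by rw [sub_smul, one_smul]; exact hA'.2)
  have smul_nn : ∀ {c : ℂ} {M : H →L[ℂ] H}, 0 ≤ c → 0 ≤ M → 0 ≤ c • M := fun hc hM =>
    (ContinuousLinearMap.nonneg_iff_isPositive _).2
      (((ContinuousLinearMap.nonneg_iff_isPositive _).1 hM).smul_of_nonneg hc)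
  have smul_mem : ∀ {c : ℂ} {M : H →L[ℂ] H}, 0 ≤ c → 0 ≤ 1 - c → M ∈ EffectSet H →
      c • M ∈ EffectSet H := by
    intro c M h0 h1 hM
    rw [mem_effectSet_iff] at hM ⊢
    refine ⟨smul_nn h0 hM.1, ?_⟩
    have : 1 - c • M = (1 - c) • (1 : H →L[ℂ] H) + c • (1 - M) := by
      rw [sub_smul, smul_sub, one_smul]; abel
    rw [this]
    have h2 : 0 ≤ (1 : H →L[ℂ] H) :=
      (ContinuousLinearMap.nonneg_iff_isPositive _).2 ContinuousLinearMap.isPositive_one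
    exact add_nonneg (smul_nn h1 h2) (smul_nn h0 hM.2)
  refine ⟨(1 - t) • C, smul_mem ht1 (by simpa using ht0) hC, t • (1 - C),
    smul_mem ht0 ht1 (orthoComplement_mem_effectSet hC), t • C, smul_mem ht0 ht1 hC, ?_, ?_, ?_⟩
  · rw [← add_smul]; simp
  · rw [← smul_add]; simp
  · have : (1 - t) • C + t • (1 - C) + t • C = 1 - (1 - t) • (1 - C) := by
      simp only [sub_smul, smul_sub, one_smul]; abel
    rw [this]
    exact orthoComplement_mem_effectSet
      (smul_mem ht1 (by simpa using ht0) (orthoComplement_mem_effectSet hC))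

end Strength

section Generic

open scoped InnerProductSpace Topology

variable {H : Type*} [NormedAddCommGroup H] [InnerProductSpace ℂ H]

/-! ### Entire functions and generic vectors -/

theorem eq_zero_of_entire_of_eventually {g : ℂ → ℂ} (hg : Differentiable ℂ g)
    (h : ∃ᶠ z in 𝓝[≠] (0 : ℂ), g z = 0) (z : ℂ) : g z = 0 := by
  have := AnalyticOnNhd.eq_of_frequently_eq (f := g) (g := fun _ => 0) (z₀ := 0)
    (fun z _ => hg.analyticAt z) (fun z _ => analyticAt_const) h
  exact congrFun this z

theorem eq_zero_of_entire_of_real {g : ℂ → ℂ} (hg : Differentiable ℂ g)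
    (h : ∀ t : ℝ, g t = 0) (z : ℂ) : g z = 0 := by
  refine eq_zero_of_entire_of_eventually hg ?_ z
  have ht : Filter.Tendsto (fun t : ℝ => (t : ℂ)) (𝓝[≠] 0) (𝓝[≠] 0) := by
    refine tendsto_nhdsWithin_iff.2 ⟨?_, ?_⟩
    · exact (Complex.continuous_ofReal.tendsto' 0 0 (by simp)).mono_left nhdsWithin_le_nhds
    · filter_upwards [self_mem_nhdsWithin] with t ht
      simpa using ht
  exact ht.frequently (Filter.Frequently.of_forall h)

theorem dense_ne_zero_of_entire {g : H → ℂ} (hg : Differentiable ℂ g) {v : H} (hv : g v ≠ 0) :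
    Dense {x | g x ≠ 0} := by
  intro x
  by_contra hx
  have hnhds : ∀ᶠ y in 𝓝 x, g y = 0 := by
    filter_upwards [isClosed_closure.isOpen_compl.mem_nhds hx] with y hy
    by_contra h
    exact hy (subset_closure h)
  have ht : Filter.Tendsto (fun z : ℂ => x + z • (v - x)) (𝓝[≠] 0) (𝓝 x) :=
    ((by fun_prop : Continuous fun z : ℂ => x + z • (v - x)).tendsto' 0 x (by simp)).mono_left
      nhdsWithin_le_nhds
  have h1 := eq_zero_of_entire_of_eventually (g := fun z : ℂ => g (x + z • (v - x)))
    (hg.comp (by fun_prop)) (ht.eventually hnhds).frequently 1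
  exact hv (by simpa using h1)

theorem exists_eq_smul_one_of_forall_eigenvector {W : H →L[ℂ] H}
    (h : ∀ u, ∃ c : ℂ, W u = c • u) : ∃ c : ℂ, W = c • 1 := by
  obtain ⟨c, hc⟩ := LinearMap.exists_eq_smul_id_of_forall_notLinearIndependent
    (f := (W : H →ₗ[ℂ] H)) (fun v hv => by
      obtain ⟨c, hc⟩ := h v
      have := LinearIndependent.pair_iff.1 hv c (-1) (by simp [hc])
      simp at this)
  refine ⟨c, ContinuousLinearMap.ext fun x => ?_⟩
  exact LinearMap.congr_fun hc x

/-- The component of `w` orthogonal to `u`, scaled by `‖u‖²` to avoid division. It vanishes for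
`w = W u` exactly when `u` is zero or an eigenvector of `W`. -/
noncomputable def orthPart (u w : H) : H := (⟪u, u⟫_ℂ) • w - ⟪u, w⟫_ℂ • u

theorem inner_orthPart (u w : H) : ⟪u, orthPart u w⟫_ℂ = 0 := by
  rw [orthPart, inner_sub_right, inner_smul_right, inner_smul_right, mul_comm, sub_self]

/-- Polarization: an entire relation between the quadratic forms `⟪x, P i x⟫` holds between the
sesquilinear forms `⟪y, P i x⟫`. Along the complex line `x + λ (y - x)` the forms are polynomials in
`λ` and `conj λ`, and a relation for these is one for two independent variables `λ`, `μ`; the values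
`λ = 0`, `μ = 1` give the claim. -/
theorem inner_eq_of_inner_self_eq {ι : Type*} [Fintype ι] (P : ι → H →L[ℂ] H) {Φ : (ι → ℂ) → ℂ}
    (hΦ : Differentiable ℂ Φ) (h : ∀ x, Φ (fun i => ⟪x, P i x⟫_ℂ) = 0) (x y : H) :
    Φ (fun i => ⟪y, P i x⟫_ℂ) = 0 := by
  let b := y - x
  -- Here `λ = s + i t` and `μ = s - i t`, which is `conj λ` for real `s` and `t`.
  let g : ℂ → ℂ → ℂ := fun s t => Φ fun i =>
    ⟪x, P i x⟫_ℂ + (s + Complex.I * t) * ⟪x, P i b⟫_ℂ + (s - Complex.I * t) * ⟪b, P i x⟫_ℂ +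
      (s + Complex.I * t) * (s - Complex.I * t) * ⟪b, P i b⟫_ℂ
  have hreal : ∀ s t : ℝ, g s t = 0 := by
    intro s t
    rw [← h (x + ((s : ℂ) + Complex.I * t) • b)]
    refine congrArg Φ (funext fun i => ?_)
    simp only [map_add, map_smul, inner_add_left, inner_add_right, inner_smul_left,
      inner_smul_right, map_mul, Complex.conj_I, Complex.conj_ofReal]
    ring
  have h1 : ∀ (s : ℝ) (t : ℂ), g s t = 0 := fun s =>
    eq_zero_of_entire_of_real (hΦ.comp (by fun_prop)) (hreal s)
  have h2 : ∀ s t : ℂ, g s t = 0 := fun s t =>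
    eq_zero_of_entire_of_real (g := fun s => g s t) (hΦ.comp (by fun_prop)) (fun s => h1 s t) s
  rw [← h2 (1 / 2) (Complex.I / 2)]
  refine congrArg Φ (funext fun i => ?_)
  have e1 : (1 / 2 + Complex.I * (Complex.I / 2) : ℂ) = 0 := by
    linear_combination Complex.I_mul_I / 2
  have e2 : (1 / 2 - Complex.I * (Complex.I / 2) : ℂ) = 1 := by
    linear_combination -Complex.I_mul_I / 2
  rw [e1, e2]
  simp only [b, inner_sub_left]
  ring

variable [CompleteSpace H]

/-- The non-vanishing sets of finitely many nonzero entire functions are open and dense, so they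
meet. -/
theorem exists_forall_ne_zero_of_entire {ι : Type*} [Finite ι] {g : ι → H → ℂ}
    (hg : ∀ i, Differentiable ℂ (g i)) (h : ∀ i, ∃ v, g i v ≠ 0) : ∃ v, ∀ i, g i v ≠ 0 := by
  have hd : Dense (⋂ i, {x | g i x ≠ 0}) :=
    dense_iInter_of_isOpen (fun i => isOpen_ne_fun (hg i).continuous continuous_const)
      fun i => dense_ne_zero_of_entire (hg i) (h i).choose_spec
  obtain ⟨v, hv⟩ := hd.nonempty
  exact ⟨v, by simpa using hv⟩

/-- If `u ⟂ y` forces one of the finitely many numbers `⟪W i u, y⟫` to vanish, then one of the `W i`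
is scalar: otherwise a generic `u` is an eigenvector of none of them, and a generic `y ⟂ u` is
orthogonal to none of the `W i u`. -/
theorem exists_eq_smul_one_of_prod_inner_eq_zero {ι : Type*} [Fintype ι] (W : ι → H →L[ℂ] H)
    (h : ∀ u y, ⟪u, y⟫_ℂ = 0 → ∏ i, ⟪W i u, y⟫_ℂ = 0) : ∃ i, ∃ c : ℂ, W i = c • 1 := by
  by_contra! hcon
  have hq : ∀ i, ∃ u, orthPart u (W i u) ≠ 0 := by
    intro i
    by_contra! h0
    obtain ⟨c, hc⟩ := exists_eq_smul_one_of_forall_eigenvector (W := W i) fun u => by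
      rcases eq_or_ne u 0 with rfl | hu
      · exact ⟨0, by simp⟩
      · refine ⟨⟪u, W i u⟫_ℂ / ⟪u, u⟫_ℂ, ?_⟩
        have := h0 u
        rw [orthPart, sub_eq_zero] at this
        rw [div_eq_inv_mul, mul_smul, ← this, smul_smul, inv_mul_cancel₀ (inner_self_ne_zero.2 hu),
          one_smul]
    exact hcon i c hc
  choose a ha using hq
  let b : ι → H := fun i => orthPart (a i) (W i (a i))
  have hab : ∀ i, ⟪b i, a i⟫_ℂ = 0 := fun i => by
    rw [← inner_conj_symm, inner_orthPart, map_zero]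
  -- These functions vanish at every eigenvector of `W i`, and not at `a i`.
  obtain ⟨u, hu⟩ := exists_forall_ne_zero_of_entire
    (g := fun i u => innerSL ℂ (a i) u * innerSL ℂ (b i) (W i u) -
      innerSL ℂ (b i) u * innerSL ℂ (a i) (W i u))
    (fun i => by fun_prop) (fun i => ⟨a i, by
      simp only [innerSL_apply_apply, hab, zero_mul, sub_zero]
      have : ⟪b i, b i⟫_ℂ = ⟪a i, a i⟫_ℂ * ⟪b i, W i (a i)⟫_ℂ := by
        change ⟪b i, orthPart (a i) (W i (a i))⟫_ℂ = _
        rw [orthPart, inner_sub_right, inner_smul_right, inner_smul_right, hab]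
        simp
      rw [← this]
      exact inner_self_ne_zero.2 (ha i)⟩)
  have hq : ∀ i, orthPart u (W i u) ≠ 0 := by
    intro i h0
    have hi := hu i
    rw [orthPart, sub_eq_zero] at h0
    have hu0 : u ≠ 0 := by rintro rfl; simp at hi
    have hW : W i u = (⟪u, W i u⟫_ℂ / ⟪u, u⟫_ℂ) • u := by
      rw [div_eq_inv_mul, mul_smul, ← h0, smul_smul, inv_mul_cancel₀ (inner_self_ne_zero.2 hu0),
          one_smul]
    apply hi
    rw [hW]
    simp only [map_smul, smul_eq_mul]
    ring
  obtain ⟨y, hy⟩ := exists_forall_ne_zero_of_entire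
    (g := fun i y => innerSL ℂ (orthPart u (W i u)) y) (fun i => by fun_prop)
    (fun i => ⟨orthPart u (W i u), inner_self_ne_zero.2 (hq i)⟩)
  have hprod := h u (orthPart u y) (inner_orthPart u y)
  rw [Finset.prod_eq_zero_iff] at hprod
  obtain ⟨i, -, hi⟩ := hprod
  apply hy i
  rw [← hi]
  simp only [innerSL_apply_apply, orthPart, inner_sub_left, inner_sub_right,
    inner_smul_left, inner_smul_right, inner_conj_symm]
  ring

end Generic

section Determination

open scoped InnerProductSpace Topology

variable {H : Type*} [NormedAddCommGroup H] [InnerProductSpace ℂ H]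

/-! ### Scalar operators -/

/-- The operator is a scalar multiple of the identity. -/
def IsScalarOp (A : H →L[ℂ] H) : Prop := ∃ c : ℂ, A = c • (1 : H →L[ℂ] H)

theorem IsScalarOp.smul {A : H →L[ℂ] H} (h : IsScalarOp A) (c : ℂ) : IsScalarOp (c • A) := by
  obtain ⟨d, rfl⟩ := h
  exact ⟨c * d, smul_smul _ _ _⟩

theorem IsScalarOp.one_sub {A : H →L[ℂ] H} (h : IsScalarOp A) : IsScalarOp (1 - A) := by
  obtain ⟨d, rfl⟩ := h
  exact ⟨1 - d, by rw [sub_smul, one_smul]⟩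

theorem IsScalarOp.of_one_sub {A : H →L[ℂ] H} (h : IsScalarOp (1 - A)) : IsScalarOp A := by
  simpa only [sub_sub_cancel] using h.one_sub

theorem isScalarOp_of_smul_eq {A : H →L[ℂ] H} {a b : ℂ} (ha : a ≠ 0)
    (h : a • A = b • (1 : H →L[ℂ] H)) : IsScalarOp A :=
  ⟨a⁻¹ * b, by rw [mul_smul, ← h, smul_smul, inv_mul_cancel₀ ha, one_smul]⟩

theorem eq_zero_of_smul_one_eq_zero [Nontrivial H] {b : ℂ} (h : b • (1 : H →L[ℂ] H) = 0) :
    b = 0 :=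
  (smul_eq_zero.1 h).resolve_right one_ne_zero

theorem isScalarOp_of_eq_smul_of_one_sub_eq_smul [Nontrivial H] {A B : H →L[ℂ] H} {c d : ℂ}
    (h1 : A = c • B) (h2 : 1 - A = d • B) : IsScalarOp B := by
  have h : (c + d) • B = (1 : ℂ) • (1 : H →L[ℂ] H) := by
    rw [add_smul, ← h1, ← h2, one_smul]; abel
  refine isScalarOp_of_smul_eq (fun h0 => ?_) h
  rw [h0, zero_smul] at h
  exact one_ne_zero (eq_zero_of_smul_one_eq_zero h.symm)

theorem isScalarOp_of_eq_smul_one_sub [Nontrivial H] {A : H →L[ℂ] H} {c : ℂ}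
    (h : A = c • (1 - A)) : IsScalarOp A :=
  (isScalarOp_of_eq_smul_of_one_sub_eq_smul h (one_smul ℂ _).symm).of_one_sub

theorem eq_or_isScalarOp_of_eq_smul [Nontrivial H] {A B : H →L[ℂ] H} {c d : ℂ}
    (h1 : A = c • B) (h2 : 1 - A = d • (1 - B)) : A = B ∨ IsScalarOp B := by
  have h : (c - d) • B = (1 - d) • (1 : H →L[ℂ] H) := by
    rw [smul_sub, h1] at h2
    rw [sub_smul, sub_smul, one_smul, sub_eq_sub_iff_add_eq_add]
    rw [sub_eq_sub_iff_add_eq_add] at h2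
    rw [add_comm, ← h2]
  by_cases h0 : c - d = 0
  · left
    rw [h0, zero_smul] at h
    have hd := eq_zero_of_smul_one_eq_zero h.symm
    have hc : c = 1 := by linear_combination h0 - hd
    rw [h1, hc, one_smul]
  · exact Or.inr (isScalarOp_of_smul_eq h0 h)

/-! ### Subspaces and lines -/

theorem eventually_add_smul_notMem {E : Type*} [AddCommGroup E] [Module ℂ E] {V : Submodule ℂ E}
    (x : E) {z : E} (hz : z ∉ V) : ∀ᶠ t : ℂ in 𝓝[≠] 0, x + t • z ∉ V := by
  by_cases h : ∃ t₀ : ℂ, t₀ ≠ 0 ∧ x + t₀ • z ∈ V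
  · obtain ⟨t₀, ht₀, hmem⟩ := h
    filter_upwards [nhdsWithin_le_nhds (eventually_ne_nhds ht₀.symm)] with t ht hmem'
    have h1 : (t - t₀) • z ∈ V := by
      have := V.sub_mem hmem' hmem
      rwa [add_sub_add_left_eq_sub, ← sub_smul] at this
    exact hz ((V.smul_mem_iff (sub_ne_zero.2 ht)).1 h1)
  · push Not at h
    filter_upwards [self_mem_nhdsWithin] with t ht using h t ht

theorem le_or_le_of_subset_union {E : Type*} [AddCommGroup E] [Module ℂ E] {U V W : Submodule ℂ E}
    (h : ∀ x ∈ U, x ∈ V ∨ x ∈ W) : U ≤ V ∨ U ≤ W := by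
  by_contra! hcon
  obtain ⟨x, hxU, hxV⟩ := SetLike.not_le_iff_exists.1 hcon.1
  obtain ⟨y, hyU, hyW⟩ := SetLike.not_le_iff_exists.1 hcon.2
  have hxW := (h x hxU).resolve_left hxV
  have hyV := (h y hyU).resolve_right hyW
  rcases h _ (U.add_mem hxU hyU) with h' | h'
  · exact hxV ((V.add_mem_iff_left hyV).1 h')
  · exact hyW ((W.add_mem_iff_right hxW).1 h')

variable [CompleteSpace H]

theorem continuous_inv_strength_line {A : H →L[ℂ] H} (hA : 0 ≤ A) {x z : H}
    (hx : x ∈ sqrtRange A) (hz : z ∈ sqrtRange A) :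
    Continuous fun t : ℂ => (strength A (x + t • z))⁻¹ := by
  obtain ⟨v, hv, rfl⟩ := exists_orthogonal_ker_of_mem_sqrtRange hx
  obtain ⟨w, hw, rfl⟩ := exists_orthogonal_ker_of_mem_sqrtRange hz
  have h : ∀ t : ℂ, (strength A (CFC.sqrt A v + t • CFC.sqrt A w))⁻¹ = ‖v + t • w‖ ^ 2 := by
    intro t
    rw [← map_smul, ← map_add,
      strength_sqrt hA (Submodule.add_mem _ hv (Submodule.smul_mem _ t hw)), inv_inv]
  simp only [h]
  fun_prop

/-- If `A^{1/2}` and `B^{1/2}` have the same range, and some `z` in it lies in the ranges of neither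
`(1 - A)^{1/2}` nor `(1 - B)^{1/2}`, then on almost all of the line `x + t z` only the strengths of
`A` and of `B` contribute, so these agree; letting `t → 0` they agree at `x`. -/
theorem eq_of_exists_notMem {A B : H →L[ℂ] H} (hA : A ∈ EffectSet H) (hB : B ∈ EffectSet H)
    (hf : ∀ x, x ≠ 0 →
      strength A x + strength (1 - A) x = strength B x + strength (1 - B) x)
    (hU : sqrtRange A = sqrtRange B) {z : H} (hz : z ∈ sqrtRange A)
    (hzA : z ∉ sqrtRange (1 - A)) (hzB : z ∉ sqrtRange (1 - B)) : A = B := by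
  have hA' := mem_effectSet_iff.1 hA
  have hB' := mem_effectSet_iff.1 hB
  refine eq_of_strength_eq hA'.1 hB'.1 fun x hx => ?_
  by_cases hxA : x ∈ sqrtRange A
  swap
  · rw [strength_of_notMem hA'.1 hxA, strength_of_notMem hB'.1 (hU ▸ hxA)]
  have hcA := (continuous_inv_strength_line hA'.1 hxA hz).tendsto 0
  have hcB := (continuous_inv_strength_line hB'.1 (hU ▸ hxA) (hU ▸ hz)).tendsto 0
  have heq : (fun t : ℂ => (strength A (x + t • z))⁻¹) =ᶠ[𝓝[≠] 0]
      fun t : ℂ => (strength B (x + t • z))⁻¹ := by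
    filter_upwards [eventually_add_smul_notMem x hzA, eventually_add_smul_notMem x hzB]
      with t h1 h2
    have h0 : x + t • z ≠ 0 := fun h => h1 (h ▸ Submodule.zero_mem _)
    have := hf _ h0
    rw [strength_of_notMem hA'.2 h1, strength_of_notMem hB'.2 h2, add_zero, add_zero] at this
    rw [this]
  have := tendsto_nhds_unique ((hcA.mono_left nhdsWithin_le_nhds).congr' heq)
    (hcB.mono_left nhdsWithin_le_nhds)
  simpa using this

theorem sqrtRange_sup_sqrtRange_one_sub {A : H →L[ℂ] H} (hA : A ∈ EffectSet H) :
    sqrtRange A ⊔ sqrtRange (1 - A) = ⊤ := by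
  have hA' := mem_effectSet_iff.1 hA
  refine Submodule.eq_top_iff'.2 fun x => ?_
  have h₁ : A x ∈ sqrtRange A := ⟨(CFC.sqrt A : H →L[ℂ] H) x, sqrt_sqrt_apply hA'.1 x⟩
  have h₂ : (1 - A) x ∈ sqrtRange (1 - A) :=
    ⟨(CFC.sqrt (1 - A) : H →L[ℂ] H) x, sqrt_sqrt_apply hA'.2 x⟩
  have hx : A x + (1 - A) x = x := by simp
  exact hx ▸ Submodule.add_mem_sup h₁ h₂

/-! ### Invertible effects -/

theorem isUnit_of_sqrtRange_eq_top {A : H →L[ℂ] H} (hA : 0 ≤ A) (h : sqrtRange A = ⊤) :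
    IsUnit A := by
  have hsurj : Function.Surjective (CFC.sqrt A : H →L[ℂ] H) := LinearMap.range_eq_top.1 h
  have hinj : Function.Injective (CFC.sqrt A : H →L[ℂ] H) := by
    refine (injective_iff_map_eq_zero _).2 fun x hx => ext_inner_right ℂ fun y => ?_
    obtain ⟨w, rfl⟩ := hsurj y
    rw [← inner_sqrt_left, hx, inner_zero_left, inner_zero_left]
  have hS : IsUnit (CFC.sqrt A) := ContinuousLinearMap.isUnit_iff_bijective.2 ⟨hinj, hsurj⟩
  rw [← CFC.sqrt_mul_sqrt_self A hA]
  exact hS.mul hS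

/-- For invertible `A` the inverse of the strength is the form of `A⁻¹`, on all of `H`. -/
theorem inner_inverse_apply_self {A : H →L[ℂ] H} (hA : 0 ≤ A) (hu : IsUnit A) (x : H) :
    ⟪x, Ring.inverse A x⟫_ℂ = ((strength A x)⁻¹ : ℝ) := by
  have hx : A (Ring.inverse A x) = x :=
    congrArg (fun T : H →L[ℂ] H => T x) (Ring.mul_inverse_cancel A hu)
  set u := Ring.inverse A x
  rw [← hx, strength_apply hA, inv_inv, reApplyInnerSelf_eq_norm_sqrt_sq hA, ← sqrt_sqrt_apply hA,
    inner_sqrt_left, inner_self_eq_norm_sq_to_K]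
  push_cast
  rfl

theorem strength_pos_of_sqrtRange_eq_top {A : H →L[ℂ] H} (hA : 0 ≤ A) (h : sqrtRange A = ⊤)
    {x : H} (hx : x ≠ 0) : 0 < strength A x :=
  (mem_sqrtRange_iff_strength_pos hA hx).1 (h ▸ Submodule.mem_top)

/-- If `y ⟂ A⁻¹ x` forces `y ⟂ (B i)⁻¹ x` for some `i`, then `A` is a multiple of one of the `B i`:
put `x = A u` and look at the operators `(B i)⁻¹ A`. -/
theorem exists_eq_smul_of_prod_inner_inverse_eq_zero {ι : Type*} [Fintype ι] {A : H →L[ℂ] H}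
    (hA : IsUnit A) {B : ι → H →L[ℂ] H} (hB : ∀ i, IsUnit (B i))
    (h : ∀ x y, ⟪y, Ring.inverse A x⟫_ℂ = 0 → ∏ i, ⟪y, Ring.inverse (B i) x⟫_ℂ = 0) :
    ∃ i, ∃ c : ℂ, A = c • B i := by
  obtain ⟨i, c, hc⟩ := exists_eq_smul_one_of_prod_inner_eq_zero
    (fun i => Ring.inverse (B i) * A) (fun u y huy => by
      have h1 : Ring.inverse A (A u) = u :=
        congrArg (fun T : H →L[ℂ] H => T u) (Ring.inverse_mul_cancel A hA)
      have h2 := h (A u) y (by rw [h1, ← inner_conj_symm, huy, map_zero])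
      rw [← map_eq_zero (starRingEnd ℂ), map_prod] at h2
      simp only [inner_conj_symm] at h2
      exact h2)
  refine ⟨i, c, ?_⟩
  calc A = B i * (Ring.inverse (B i) * A) := by
        rw [← mul_assoc, Ring.mul_inverse_cancel _ (hB i), one_mul]
    _ = c • B i := by rw [hc, mul_smul_comm, mul_one]

/-- Here `A`, `1 - A`, `B` are invertible and `1 - B` is not. Write `p`, `q`, `r` for the forms of
the three inverses. Off the range of `(1 - B)^{1/2}` the hypothesis is `1/p + 1/q = 1/r`, so
`(p + q) r = p q` everywhere. -/
theorem isScalarOp_of_sqrtRange_one_sub_ne_top [Nontrivial H] {A B : H →L[ℂ] H}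
    (hA : A ∈ EffectSet H) (hB : B ∈ EffectSet H)
    (hf : ∀ x, x ≠ 0 →
      strength A x + strength (1 - A) x = strength B x + strength (1 - B) x)
    (hU₁ : sqrtRange A = ⊤) (hU₂ : sqrtRange (1 - A) = ⊤) (hV₁ : sqrtRange B = ⊤)
    (hV₂ : sqrtRange (1 - B) ≠ ⊤) : IsScalarOp A ∧ IsScalarOp B := by
  have hA' := mem_effectSet_iff.1 hA
  have hB' := mem_effectSet_iff.1 hB
  have uA := isUnit_of_sqrtRange_eq_top hA'.1 hU₁
  have uA' := isUnit_of_sqrtRange_eq_top hA'.2 hU₂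
  have uB := isUnit_of_sqrtRange_eq_top hB'.1 hV₁
  obtain ⟨z, hz⟩ : ∃ z, z ∉ sqrtRange (1 - B) := by
    by_contra! h
    exact hV₂ (Submodule.eq_top_iff'.2 h)
  have hdiag : ∀ x, x ∉ sqrtRange (1 - B) →
      (⟪x, Ring.inverse A x⟫_ℂ + ⟪x, Ring.inverse (1 - A) x⟫_ℂ) * ⟪x, Ring.inverse B x⟫_ℂ -
        ⟪x, Ring.inverse A x⟫_ℂ * ⟪x, Ring.inverse (1 - A) x⟫_ℂ = 0 := by
    intro x hxB
    have hx : x ≠ 0 := fun h => hxB (h ▸ Submodule.zero_mem _)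
    have hsum := hf x hx
    rw [strength_of_notMem hB'.2 hxB, add_zero] at hsum
    have ha := strength_pos_of_sqrtRange_eq_top hA'.1 hU₁ hx
    have ha' := strength_pos_of_sqrtRange_eq_top hA'.2 hU₂ hx
    rw [inner_inverse_apply_self hA'.1 uA, inner_inverse_apply_self hA'.2 uA',
      inner_inverse_apply_self hB'.1 uB, ← hsum]
    norm_cast
    have : strength A x + strength (1 - A) x ≠ 0 := by positivity
    field_simp
    ring
  have hdiag' : ∀ x,
      (⟪x, Ring.inverse A x⟫_ℂ + ⟪x, Ring.inverse (1 - A) x⟫_ℂ) * ⟪x, Ring.inverse B x⟫_ℂ -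
        ⟪x, Ring.inverse A x⟫_ℂ * ⟪x, Ring.inverse (1 - A) x⟫_ℂ = 0 := by
    intro x
    let F : H → ℂ := fun x =>
      (⟪x, Ring.inverse A x⟫_ℂ + ⟪x, Ring.inverse (1 - A) x⟫_ℂ) * ⟪x, Ring.inverse B x⟫_ℂ -
        ⟪x, Ring.inverse A x⟫_ℂ * ⟪x, Ring.inverse (1 - A) x⟫_ℂ
    have hF : Filter.Tendsto (fun t : ℂ => F (x + t • z)) (𝓝[≠] 0) (𝓝 (F x)) :=
      ((by fun_prop : Continuous fun t : ℂ => F (x + t • z)).tendsto' 0 (F x)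
        (by simp)).mono_left nhdsWithin_le_nhds
    refine tendsto_nhds_unique hF (tendsto_const_nhds.congr' ?_)
    filter_upwards [eventually_add_smul_notMem x hz] with t ht using (hdiag _ ht).symm
  have hpol : ∀ x y,
      (⟪y, Ring.inverse A x⟫_ℂ + ⟪y, Ring.inverse (1 - A) x⟫_ℂ) * ⟪y, Ring.inverse B x⟫_ℂ -
        ⟪y, Ring.inverse A x⟫_ℂ * ⟪y, Ring.inverse (1 - A) x⟫_ℂ = 0 := fun x y =>
    inner_eq_of_inner_self_eq ![Ring.inverse A, Ring.inverse (1 - A), Ring.inverse B]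
      (Φ := fun z => (z 0 + z 1) * z 2 - z 0 * z 1) (by fun_prop) hdiag' x y
  have h1 := exists_eq_smul_of_prod_inner_inverse_eq_zero (B := ![1 - A, B]) uA
    (by simp [Fin.forall_fin_two, uA', uB]) fun x y h0 => by
      have := hpol x y
      simp only [h0] at this
      simpa using this
  have h2 := exists_eq_smul_of_prod_inner_inverse_eq_zero (B := ![A, B]) uA'
    (by simp [Fin.forall_fin_two, uA, uB]) fun x y h0 => by
      have := hpol x y
      simp only [h0] at this
      simpa using this
  have h3 := exists_eq_smul_of_prod_inner_inverse_eq_zero (B := ![A, 1 - A]) uB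
    (by simp [Fin.forall_fin_two, uA, uA']) fun x y h0 => by
      have := hpol x y
      simp only [h0] at this
      simpa using this
  simp only [Fin.exists_fin_two, Matrix.cons_val_zero, Matrix.cons_val_one] at h1 h2 h3
  have sA : IsScalarOp A := by
    rcases h1 with ⟨c, hc⟩ | ⟨c, hc⟩
    · exact isScalarOp_of_eq_smul_one_sub hc
    · rcases h2 with ⟨d, hd⟩ | ⟨d, hd⟩
      · exact (isScalarOp_of_eq_smul_of_one_sub_eq_smul (one_smul ℂ A).symm hd)
      · rw [hc]
        exact (isScalarOp_of_eq_smul_of_one_sub_eq_smul hc hd).smul c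
  refine ⟨sA, ?_⟩
  rcases h3 with ⟨e, he⟩ | ⟨e, he⟩
  · rw [he]; exact sA.smul e
  · rw [he]; exact sA.one_sub.smul e

/-- Here `A`, `1 - A`, `B`, `1 - B` are invertible. With `p`, `q`, `r`, `s` for the forms of the
four inverses, the hypothesis `1/p + 1/q = 1/r + 1/s` becomes `(p + q) r s = (r + s) p q`. -/
theorem eq_or_isScalarOp_of_all_sqrtRange_eq_top [Nontrivial H] {A B : H →L[ℂ] H}
    (hA : A ∈ EffectSet H) (hB : B ∈ EffectSet H)
    (hf : ∀ x, x ≠ 0 →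
      strength A x + strength (1 - A) x = strength B x + strength (1 - B) x)
    (hU₁ : sqrtRange A = ⊤) (hU₂ : sqrtRange (1 - A) = ⊤) (hV₁ : sqrtRange B = ⊤)
    (hV₂ : sqrtRange (1 - B) = ⊤) :
    B = A ∨ B = 1 - A ∨ IsScalarOp A ∧ IsScalarOp B := by
  have hA' := mem_effectSet_iff.1 hA
  have hB' := mem_effectSet_iff.1 hB
  have uA := isUnit_of_sqrtRange_eq_top hA'.1 hU₁
  have uA' := isUnit_of_sqrtRange_eq_top hA'.2 hU₂
  have uB := isUnit_of_sqrtRange_eq_top hB'.1 hV₁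
  have uB' := isUnit_of_sqrtRange_eq_top hB'.2 hV₂
  have hdiag : ∀ x,
      (⟪x, Ring.inverse A x⟫_ℂ + ⟪x, Ring.inverse (1 - A) x⟫_ℂ) *
          (⟪x, Ring.inverse B x⟫_ℂ * ⟪x, Ring.inverse (1 - B) x⟫_ℂ) -
        (⟪x, Ring.inverse B x⟫_ℂ + ⟪x, Ring.inverse (1 - B) x⟫_ℂ) *
          (⟪x, Ring.inverse A x⟫_ℂ * ⟪x, Ring.inverse (1 - A) x⟫_ℂ) = 0 := by
    intro x
    rcases eq_or_ne x 0 with rfl | hx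
    · simp
    have hsum := hf x hx
    have ha := strength_pos_of_sqrtRange_eq_top hA'.1 hU₁ hx
    have ha' := strength_pos_of_sqrtRange_eq_top hA'.2 hU₂ hx
    have hb := strength_pos_of_sqrtRange_eq_top hB'.1 hV₁ hx
    have hb' := strength_pos_of_sqrtRange_eq_top hB'.2 hV₂ hx
    rw [inner_inverse_apply_self hA'.1 uA, inner_inverse_apply_self hA'.2 uA',
      inner_inverse_apply_self hB'.1 uB, inner_inverse_apply_self hB'.2 uB']
    norm_cast
    field_simp
    linear_combination hsum
  have hpol : ∀ x y,
      (⟪y, Ring.inverse A x⟫_ℂ + ⟪y, Ring.inverse (1 - A) x⟫_ℂ) *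
          (⟪y, Ring.inverse B x⟫_ℂ * ⟪y, Ring.inverse (1 - B) x⟫_ℂ) -
        (⟪y, Ring.inverse B x⟫_ℂ + ⟪y, Ring.inverse (1 - B) x⟫_ℂ) *
          (⟪y, Ring.inverse A x⟫_ℂ * ⟪y, Ring.inverse (1 - A) x⟫_ℂ) = 0 := fun x y =>
    inner_eq_of_inner_self_eq
      ![Ring.inverse A, Ring.inverse (1 - A), Ring.inverse B, Ring.inverse (1 - B)]
      (Φ := fun z => (z 0 + z 1) * (z 2 * z 3) - (z 2 + z 3) * (z 0 * z 1)) (by fun_prop)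
      hdiag x y
  have h1 := exists_eq_smul_of_prod_inner_inverse_eq_zero (B := ![1 - A, B, 1 - B]) uA
    (by simp [Fin.forall_fin_succ, uA', uB, uB']) fun x y h0 => by
      have := hpol x y
      simp only [h0] at this
      simpa [Fin.prod_univ_three, or_assoc] using this
  have h2 := exists_eq_smul_of_prod_inner_inverse_eq_zero (B := ![A, B, 1 - B]) uA'
    (by simp [Fin.forall_fin_succ, uA, uB, uB']) fun x y h0 => by
      have := hpol x y
      simp only [h0] at this
      simpa [Fin.prod_univ_three, or_assoc] using this
  have h3 := exists_eq_smul_of_prod_inner_inverse_eq_zero (B := ![1 - B, A, 1 - A]) uB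
    (by simp [Fin.forall_fin_succ, uA, uA', uB']) fun x y h0 => by
      have := hpol x y
      simp only [h0] at this
      simpa [Fin.prod_univ_three, or_assoc] using this
  simp only [Fin.exists_fin_succ, Fin.exists_fin_zero, or_false, Matrix.cons_val_zero,
    Matrix.cons_val_succ] at h1 h2 h3
  by_cases sA : IsScalarOp A
  · refine Or.inr (Or.inr ⟨sA, ?_⟩)
    rcases h3 with ⟨e, he⟩ | ⟨e, he⟩ | ⟨e, he⟩
    · exact isScalarOp_of_eq_smul_one_sub he
    · rw [he]; exact sA.smul e
    · rw [he]; exact sA.one_sub.smul e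
  have of_smul : ∀ {M : H →L[ℂ] H} {c : ℂ}, A = c • M → ¬ IsScalarOp M := fun h hM =>
    sA (h ▸ hM.smul _)
  rcases h2 with ⟨d, hd⟩ | h2
  · exact absurd (isScalarOp_of_eq_smul_of_one_sub_eq_smul (one_smul ℂ A).symm hd) sA
  rcases h1 with ⟨c, hc⟩ | ⟨c, hc⟩ | ⟨c, hc⟩
  · exact absurd (isScalarOp_of_eq_smul_one_sub hc) sA
  · rcases h2 with ⟨d, hd⟩ | ⟨d, hd⟩
    · exact absurd (isScalarOp_of_eq_smul_of_one_sub_eq_smul hc hd) (of_smul hc)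
    · exact Or.inl ((eq_or_isScalarOp_of_eq_smul hc hd).resolve_right (of_smul hc)).symm
  · rcases h2 with ⟨d, hd⟩ | ⟨d, hd⟩
    · have := (eq_or_isScalarOp_of_eq_smul (B := 1 - B) (d := d) hc
        (by rw [hd, sub_sub_cancel])).resolve_right (of_smul hc)
      exact Or.inr (Or.inl (by rw [this, sub_sub_cancel]))
    · exact absurd (isScalarOp_of_eq_smul_of_one_sub_eq_smul hc hd) (of_smul hc)

theorem eq_or_isScalarOp_of_sqrtRange_eq_top [Nontrivial H] {A B : H →L[ℂ] H}
    (hA : A ∈ EffectSet H) (hB : B ∈ EffectSet H)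
    (hf : ∀ x, x ≠ 0 →
      strength A x + strength (1 - A) x = strength B x + strength (1 - B) x)
    (hU₁ : sqrtRange A = ⊤) (hV₁ : sqrtRange B = ⊤) :
    B = A ∨ B = 1 - A ∨ IsScalarOp A ∧ IsScalarOp B := by
  by_cases hU₂ : sqrtRange (1 - A) = ⊤ <;> by_cases hV₂ : sqrtRange (1 - B) = ⊤
  · exact eq_or_isScalarOp_of_all_sqrtRange_eq_top hA hB hf hU₁ hU₂ hV₁ hV₂
  · exact Or.inr (Or.inr (isScalarOp_of_sqrtRange_one_sub_ne_top hA hB hf hU₁ hU₂ hV₁ hV₂))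
  · exact Or.inr (Or.inr (isScalarOp_of_sqrtRange_one_sub_ne_top hB hA
      (fun x hx => (hf x hx).symm) hV₁ hV₂ hU₁ hU₂).symm)
  · left
    obtain ⟨z, hz⟩ : ∃ z, ¬ (z ∈ sqrtRange (1 - A) ∨ z ∈ sqrtRange (1 - B)) := by
      by_contra! h
      rcases le_or_le_of_subset_union (U := ⊤) fun x _ => h x with h | h
      · exact hU₂ (top_le_iff.1 h)
      · exact hV₂ (top_le_iff.1 h)
    rw [not_or] at hz
    exact (eq_of_exists_notMem hA hB hf (hU₁.trans hV₁.symm) (z := z)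
      (hU₁ ▸ Submodule.mem_top) hz.1 hz.2).symm

/-! ### The effect up to complement -/

/-- The vectors along which `A` or `1 - A` has positive strength are the same for `B`. -/
theorem mem_sqrtRange_or_iff {A B : H →L[ℂ] H} (hA : A ∈ EffectSet H) (hB : B ∈ EffectSet H)
    (hf : ∀ x, x ≠ 0 →
      strength A x + strength (1 - A) x = strength B x + strength (1 - B) x) (x : H) :
    x ∈ sqrtRange A ∨ x ∈ sqrtRange (1 - A) ↔ x ∈ sqrtRange B ∨ x ∈ sqrtRange (1 - B) := by
  have hA' := mem_effectSet_iff.1 hA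
  have hB' := mem_effectSet_iff.1 hB
  rcases eq_or_ne x 0 with rfl | hx
  · simp
  have key : ∀ {a b : ℝ}, 0 ≤ a → 0 ≤ b → (0 < a ∨ 0 < b ↔ 0 < a + b) := by
    intro a b ha hb
    constructor
    · rintro (h | h) <;> linarith
    · intro h
      by_contra! h'
      linarith [h'.1, h'.2]
  rw [mem_sqrtRange_iff_strength_pos hA'.1 hx, mem_sqrtRange_iff_strength_pos hA'.2 hx,
    mem_sqrtRange_iff_strength_pos hB'.1 hx, mem_sqrtRange_iff_strength_pos hB'.2 hx,
    key (strength_nonneg _ _) (strength_nonneg _ _),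
    key (strength_nonneg _ _) (strength_nonneg _ _), hf x hx]

/-- The ranges of `A^{1/2}` and `(1 - A)^{1/2}` are proper and span `H`, so neither contains the
other. Then the equality of the unions in `mem_sqrtRange_or_iff` is an equality of pairs. -/
theorem eq_of_sqrtRange_le {A B : H →L[ℂ] H} (hA : A ∈ EffectSet H) (hB : B ∈ EffectSet H)
    (hf : ∀ x, x ≠ 0 →
      strength A x + strength (1 - A) x = strength B x + strength (1 - B) x)
    (hU₁ : sqrtRange A ≠ ⊤) (hU₂ : sqrtRange (1 - A) ≠ ⊤) (hle : sqrtRange A ≤ sqrtRange B) :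
    A = B := by
  have hcov := mem_sqrtRange_or_iff hA hB hf
  have hsup := sqrtRange_sup_sqrtRange_one_sub hA
  have n12 : ¬ sqrtRange A ≤ sqrtRange (1 - A) := fun h => hU₂ (by rwa [sup_eq_right.2 h] at hsup)
  have n21 : ¬ sqrtRange (1 - A) ≤ sqrtRange A := fun h => hU₁ (by rwa [sup_eq_left.2 h] at hsup)
  have hge : sqrtRange B ≤ sqrtRange A :=
    (le_or_le_of_subset_union fun x hx => (hcov x).2 (Or.inl hx)).resolve_right
      fun h => n12 (hle.trans h)
  have hle₂ : sqrtRange (1 - A) ≤ sqrtRange (1 - B) :=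
    (le_or_le_of_subset_union fun x hx => (hcov x).1 (Or.inr hx)).resolve_left
      fun h => n21 (h.trans hge)
  have hge₂ : sqrtRange (1 - B) ≤ sqrtRange (1 - A) :=
    (le_or_le_of_subset_union fun x hx => (hcov x).2 (Or.inr hx)).resolve_left
      fun h => n21 (hle₂.trans h)
  obtain ⟨z, hz, hzA⟩ := SetLike.not_le_iff_exists.1 n12
  exact eq_of_exists_notMem hA hB hf (le_antisymm hle hge) hz hzA fun h => hzA (hge₂ h)

/-- The sums of strengths determine an effect up to the complement, unless it is scalar. -/
theorem eq_or_isScalarOp_of_strength_add_eq [Nontrivial H] {A B : H →L[ℂ] H}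
    (hA : A ∈ EffectSet H) (hB : B ∈ EffectSet H)
    (hf : ∀ x, x ≠ 0 →
      strength A x + strength (1 - A) x = strength B x + strength (1 - B) x) :
    B = A ∨ B = 1 - A ∨ IsScalarOp A ∧ IsScalarOp B := by
  have hcov := mem_sqrtRange_or_iff hA hB hf
  have hA₂ := orthoComplement_mem_effectSet hA
  have hB₂ := orthoComplement_mem_effectSet hB
  -- `strength A + strength (1 - A)` does not change when `A` is replaced by `1 - A`.
  have hfB : ∀ x, x ≠ 0 →
      strength A x + strength (1 - A) x = strength (1 - B) x + strength (1 - (1 - B)) x := by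
    intro x hx
    rw [hf x hx, sub_sub_cancel, add_comm]
  by_cases hU : sqrtRange A ≠ ⊤ ∧ sqrtRange (1 - A) ≠ ⊤
  · rcases le_or_le_of_subset_union fun x hx => (hcov x).1 (Or.inl hx) with h | h
    · exact Or.inl (eq_of_sqrtRange_le hA hB hf hU.1 hU.2 h).symm
    · refine Or.inr (Or.inl ?_)
      rw [eq_of_sqrtRange_le hA hB₂ hfB hU.1 hU.2 h, sub_sub_cancel]
  have hU' : sqrtRange A = ⊤ ∨ sqrtRange (1 - A) = ⊤ := by
    by_contra! h
    exact hU h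
  have hV' : sqrtRange B = ⊤ ∨ sqrtRange (1 - B) = ⊤ := by
    have h : ∀ x ∈ (⊤ : Submodule ℂ H), x ∈ sqrtRange B ∨ x ∈ sqrtRange (1 - B) := by
      intro x _
      rw [← hcov]
      rcases hU' with h | h
      · exact Or.inl (h ▸ Submodule.mem_top)
      · exact Or.inr (h ▸ Submodule.mem_top)
    exact (le_or_le_of_subset_union h).imp top_le_iff.1 top_le_iff.1
  have hfA : ∀ x, x ≠ 0 →
      strength (1 - A) x + strength (1 - (1 - A)) x = strength B x + strength (1 - B) x := by
    intro x hx
    rw [← hf x hx, sub_sub_cancel, add_comm]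
  rcases hU' with hU' | hU' <;> rcases hV' with hV' | hV'
  · exact eq_or_isScalarOp_of_sqrtRange_eq_top hA hB hf hU' hV'
  · rcases eq_or_isScalarOp_of_sqrtRange_eq_top hA hB₂ hfB hU' hV' with h | h | h
    · exact Or.inr (Or.inl (by rw [← h, sub_sub_cancel]))
    · exact Or.inl (sub_right_injective h)
    · exact Or.inr (Or.inr ⟨h.1, h.2.of_one_sub⟩)
  · rcases eq_or_isScalarOp_of_sqrtRange_eq_top hA₂ hB hfA hU' hV' with h | h | h
    · exact Or.inr (Or.inl h)
    · exact Or.inl (by rw [h, sub_sub_cancel])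
    · exact Or.inr (Or.inr ⟨h.1.of_one_sub, h.2⟩)
  · have hfAB : ∀ x, x ≠ 0 → strength (1 - A) x + strength (1 - (1 - A)) x =
        strength (1 - B) x + strength (1 - (1 - B)) x := by
      intro x hx
      rw [hfA x hx, sub_sub_cancel, add_comm]
    rcases eq_or_isScalarOp_of_sqrtRange_eq_top hA₂ hB₂ hfAB hU' hV' with h | h | h
    · exact Or.inl (sub_right_injective h)
    · exact Or.inr (Or.inl (sub_right_injective h))
    · exact Or.inr (Or.inr ⟨h.1.of_one_sub, h.2.of_one_sub⟩)

end Determination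

theorem theorem1p1 {H : Type*} [NormedAddCommGroup H] [InnerProductSpace ℂ H] [CompleteSpace H]
    (hdim : 2 ≤ Module.rank ℂ H) (A B : H →L[ℂ] H) (hA : A ∈ EffectSet H) (hB : B ∈ EffectSet H) :
    (((B = A ∨ B = orthoComplement A) ∨ (A ∈ ScalarEffectSet H ∧ B ∈ ScalarEffectSet H)) ↔
      coexistenceSet A = coexistenceSet B) ∧
    (TopologicalSpace.SeparableSpace H →
      (((B = A ∨ B = orthoComplement A) ∨ (A ∈ ScalarEffectSet H ∧ B ∈ ScalarEffectSet H)) ↔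
        coexistenceSet A ∩ FiniteRankEffectSet H = coexistenceSet B ∩ FiniteRankEffectSet H)) := by
  have : Nontrivial H :=
    rank_pos_iff_nontrivial.1 (lt_of_lt_of_le (by norm_num) hdim)
  have h12 : ((B = A ∨ B = orthoComplement A) ∨
      (A ∈ ScalarEffectSet H ∧ B ∈ ScalarEffectSet H)) → coexistenceSet A = coexistenceSet B := by
    rintro ((rfl | rfl) | ⟨sA, sB⟩)
    · rfl
    · exact (coexistenceSet_orthoComplement A).symm
    · rw [coexistenceSet_of_scalar sA, coexistenceSet_of_scalar sB]
  -- Equality of the finite-rank parts suffices, whether or not `H` is separable.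
  have h31 : coexistenceSet A ∩ FiniteRankEffectSet H = coexistenceSet B ∩ FiniteRankEffectSet H →
      ((B = A ∨ B = orthoComplement A) ∨ (A ∈ ScalarEffectSet H ∧ B ∈ ScalarEffectSet H)) := by
    intro h
    rcases eq_or_isScalarOp_of_strength_add_eq hA hB
      fun x hx => strength_add_eq_of_coexistenceSet_eq hA hB h hx with h | h | h
    · exact Or.inl (Or.inl h)
    · exact Or.inl (Or.inr h)
    · exact Or.inr ⟨⟨hA, h.1⟩, ⟨hB, h.2⟩⟩
  exact ⟨⟨h12, fun h => h31 (by rw [h])⟩, fun _ => ⟨fun h => by rw [h12 h], h31⟩⟩
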